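/- Let $n$ be a natural number and $J=\begin{bmatrix}0&I_n\\-I_n&0\end{bmatrix}$. Let $\operatorname{Sp}(2n)$ be the group of real $2n\times 2n$ matrices $S$ with $S^TJS=J$, and let $\operatorname{Pd}(2n)$ be the set of real symmetric positive definite $2n\times 2n$ matrices. For $B\in\operatorname{Pd}(2n)$ let $d(B)=(d_1(B)\le\dots\le d_n(B))$ be the vector of symplectic eigenvalues of $B$, i.e. the unique non-decreasing vector $e$ with non-negative entries such that $S^TBS=\operatorname{diag}(e)\oplus\operatorname{diag}(e)$ for some $S\in\operatorname{Sp}(2n)$. Let $A=\begin{bmatrix}A_{11}&A_{12}\\A_{12}^T&A_{22}\end{bmatrix}\in\operatorname{Pd}(2n)$ with $n\times n$ blocks, let $\Delta_{11},\Delta_{22}\in\mathbb R^n$ be the vectors of diagonal entries of $A_{11}$ and $A_{22}$, and put, with entrywise operations, $$\Delta_s(A)=\sqrt{\Delta_{11}\cdot\Delta_{22}},\qquad M=\operatorname{diag}\Big(\sqrt[4]{\Delta_{11}^{-1}\cdot\Delta_{22}}\Big)\oplus\operatorname{diag}\Big(\sqrt[4]{\Delta_{22}^{-1}\cdot\Delta_{11}}\Big).$$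 Suppose that $(MAM)J=J(MAM)$. Then every $B\in\operatorname{Pd}(2n)$ with $d(B)=\Delta_s(A)^\uparrow$ (the vector $\Delta_s(A)$ with its entries rearranged in non-decreasing order) lies in the convex hull of the symplectic orbit $\{S^TAS : S\in\operatorname{Sp}(2n)\}$ of $A$. In particular, $\operatorname{diag}(\Delta_{11})\oplus\operatorname{diag}(\Delta_{22})$ lies in this convex hull. -/

import Mathlib

open Matrix

namespace Symp

noncomputable section

/-- Real `2n × 2n` matrices, seen as `2 × 2` block matrices with `n × n` blocks. -/
abbrev Mat (n : ℕ) : Type := Matrix (Fin n ⊕ Fin n) (Fin n ⊕ Fin n) ℝ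

/-- The diagonal of the upper left `n × n` block. -/
def Δ11 {n : ℕ} (A : Mat n) : Fin n → ℝ := fun i => A.toBlocks₁₁ i i

/-- The diagonal of the lower right `n × n` block. -/
def Δ22 {n : ℕ} (A : Mat n) : Fin n → ℝ := fun i => A.toBlocks₂₂ i i

/-- The entrywise geometric mean of the two diagonals. -/
def Δs {n : ℕ} (A : Mat n) : Fin n → ℝ := fun i => Real.sqrt (Δ11 A i * Δ22 A i)

/-- The direct sum `diag(u) ⊕ diag(v)`. -/
def diagSum {n : ℕ} (u v : Fin n → ℝ) : Mat n :=
  Matrix.fromBlocks (Matrix.diagonal u) 0 0 (Matrix.diagonal v)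

/-- The symplectic diagonal scaling
`diag((Δ22 / Δ11)^{1/4}) ⊕ diag((Δ11 / Δ22)^{1/4})` associated with `A`. -/
def scaling {n : ℕ} (A : Mat n) : Mat n :=
  diagSum (fun i => ((Δ11 A i)⁻¹ * Δ22 A i) ^ ((1 : ℝ) / 4))
    (fun i => ((Δ22 A i)⁻¹ * Δ11 A i) ^ ((1 : ℝ) / 4))

/-- The vector `v` with its entries rearranged in non-decreasing order. -/
def sortUp {n : ℕ} (v : Fin n → ℝ) : Fin n → ℝ := v ∘ Tuple.sort v

/-- `e` lists, in non-decreasing order, the diagonal of a Williamson normal form of `A`: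
`e₁ ≤ ⋯ ≤ eₙ` are non-negative and `Mᵀ A M = diag(e) ⊕ diag(e)` for some symplectic `M`.
(Mathlib's symplectic group is `{M | M J Mᵀ = J}`, which is the same set as
`{M | Mᵀ J M = J}`, and which does not change when `J` is replaced by `-J`.) -/
def IsSymplecticSpectrum {n : ℕ} (A : Mat n) (e : Fin n → ℝ) : Prop :=
  Monotone e ∧ (∀ i, 0 ≤ e i) ∧
    ∃ M ∈ Matrix.symplecticGroup (Fin n) ℝ, Mᵀ * A * M = diagSum e e

open Classical in
/-- The vector `d(A)` of symplectic eigenvalues of `A` in non-decreasing order. For positive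
definite `A` it exists and is unique by Williamson's theorem; the value is `0` for
matrices that have no Williamson normal form. -/
def d {n : ℕ} (A : Mat n) : Fin n → ℝ :=
  if h : ∃ e, IsSymplecticSpectrum A e then h.choose else 0

/-- The symplectic orbit `{Mᵀ A M : M ∈ Sp(2n)}` of `A`. -/
def orbit {n : ℕ} (A : Mat n) : Set (Mat n) :=
  {X | ∃ M ∈ Matrix.symplecticGroup (Fin n) ℝ, X = Mᵀ * A * M}

end

end Symp

namespace Symp

variable {n : ℕ}

/-! The convex hull of the orbit of `A` is stable under symplectic congruence and its inverse, so
one point of it suffices. The scaling is symplectic, so `X = MAM` lies in the orbit, and both of its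
diagonals equal `Δs A`. Commutation with `J` makes the off-diagonal block of `X` skew, hence zero on
its diagonal; averaging `X` over sign changes (`diagSum_mem_convexHull_orbit`) then leaves `diagSum
(Δs A) (Δs A)`. Williamson's form and a permutation of modes link `B` to this matrix, and `scaling
A` links `diagSum (Δ11 A) (Δ22 A)` to it. -/

theorem diagSum_mul_diagSum (u v u' v' : Fin n → ℝ) :
    diagSum u v * diagSum u' v' = diagSum (fun i => u i * u' i) (fun i => v i * v' i) := by
  simp [diagSum, diagonal_mul_diagonal]

theorem transpose_diagSum (u v : Fin n → ℝ) : (diagSum u v)ᵀ = diagSum u v := by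
  simp [diagSum]

theorem fromBlocks_diag_mem_symplecticGroup {P Q : Matrix (Fin n) (Fin n) ℝ}
    (h : P * Qᵀ = 1) : fromBlocks P 0 0 Q ∈ symplecticGroup (Fin n) ℝ := by
  have h' : Q * Pᵀ = 1 := by simpa using congrArg transpose h
  rw [SymplecticGroup.mem_iff]
  simp [J, fromBlocks_transpose, fromBlocks_multiply, h, h']

theorem diagSum_mem_symplecticGroup {u v : Fin n → ℝ} (h : ∀ i, u i * v i = 1) :
    diagSum u v ∈ symplecticGroup (Fin n) ℝ := by
  refine fromBlocks_diag_mem_symplecticGroup ?_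
  rw [diagonal_transpose, diagonal_mul_diagonal]
  simp [h]

theorem diagSum_conj_apply_inl_inl (u v : Fin n → ℝ) (X : Mat n) (i j : Fin n) :
    (diagSum u v * X * diagSum u v) (.inl i) (.inl j) = u i * u j * X (.inl i) (.inl j) := by
  simp [diagSum, diagonal_mul, mul_diagonal]
  ring

theorem diagSum_conj_apply_inl_inr (u v : Fin n → ℝ) (X : Mat n) (i j : Fin n) :
    (diagSum u v * X * diagSum u v) (.inl i) (.inr j) = u i * v j * X (.inl i) (.inr j) := by
  simp [diagSum, diagonal_mul, mul_diagonal]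
  ring

theorem diagSum_conj_apply_inr_inl (u v : Fin n → ℝ) (X : Mat n) (i j : Fin n) :
    (diagSum u v * X * diagSum u v) (.inr i) (.inl j) = v i * u j * X (.inr i) (.inl j) := by
  simp [diagSum, diagonal_mul, mul_diagonal]
  ring

theorem diagSum_conj_apply_inr_inr (u v : Fin n → ℝ) (X : Mat n) (i j : Fin n) :
    (diagSum u v * X * diagSum u v) (.inr i) (.inr j) = v i * v j * X (.inr i) (.inr j) := by
  simp [diagSum, diagonal_mul, mul_diagonal]
  ring

/-- The convex hull of a symplectic orbit is invariant under symplectic congruence. -/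
theorem conj_mem_convexHull_orbit {A X S : Mat n} (hS : S ∈ symplecticGroup (Fin n) ℝ)
    (hX : X ∈ convexHull ℝ (orbit A)) : Sᵀ * X * S ∈ convexHull ℝ (orbit A) := by
  let f : Mat n →ₗ[ℝ] Mat n := (LinearMap.mulRight ℝ S).comp (LinearMap.mulLeft ℝ Sᵀ)
  have hf : f '' orbit A ⊆ orbit A := by
    rintro _ ⟨_, ⟨M, hM, rfl⟩, rfl⟩
    exact ⟨M * S, mul_mem hM hS, by simp [f, Matrix.mul_assoc]⟩
  exact convexHull_mono hf (f.image_convexHull (orbit A) ▸ Set.mem_image_of_mem f hX)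

/-- The convex hull of the orbit of `A` contains that of every matrix in it. -/
theorem mem_convexHull_orbit_of_conj_eq {A X Y S : Mat n}
    (hS : S ∈ symplecticGroup (Fin n) ℝ) (hX : X ∈ convexHull ℝ (orbit A))
    (h : Sᵀ * Y * S = X) : Y ∈ convexHull ℝ (orbit A) := by
  obtain ⟨T, hT⟩ : ∃ T : symplecticGroup (Fin n) ℝ, S * T.1 = 1 :=
    ⟨(⟨S, hS⟩ : symplecticGroup (Fin n) ℝ)⁻¹,
      congrArg Subtype.val (mul_inv_cancel (⟨S, hS⟩ : symplecticGroup (Fin n) ℝ))⟩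
  have hT' : T.1ᵀ * Sᵀ = 1 := by simpa using congrArg transpose hT
  have hY : Y = T.1ᵀ * X * T.1 := by
    calc Y = (T.1ᵀ * Sᵀ) * Y * (S * T.1) := by simp [hT, hT']
      _ = T.1ᵀ * X * T.1 := by simp only [← h, Matrix.mul_assoc]
  exact hY ▸ conj_mem_convexHull_orbit T.2 hX

/-- Orthogonality of the coordinate characters of the group of sign vectors. -/
theorem sum_sign_mul_sign (i j : Fin n) :
    ∑ s : Fin n → ℤˣ, ((s i : ℤ) : ℝ) * ((s j : ℤ) : ℝ) = if i = j then 2 ^ n else 0 := by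
  split_ifs with hij
  · subst hij
    have h (s : Fin n → ℤˣ) : ((s i : ℤ) : ℝ) * ((s i : ℤ) : ℝ) = 1 := by
      rcases Int.units_eq_one_or (s i) with h | h <;> simp [h]
    simp [h]
  -- Flipping the `i`-th sign permutes the sign vectors and negates the sum.
  · have h := Equiv.sum_comp (Equiv.mulLeft (Pi.mulSingle i (-1) : Fin n → ℤˣ))
      (fun s : Fin n → ℤˣ => ((s i : ℤ) : ℝ) * ((s j : ℤ) : ℝ))
    have hj : (Pi.mulSingle i (-1) : Fin n → ℤˣ) j = 1 := Pi.mulSingle_eq_of_ne' hij _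
    simp only [Equiv.coe_mulLeft, Pi.mul_apply, Pi.mulSingle_eq_same, hj] at h
    simp only [neg_mul, one_mul, Units.val_neg, Int.cast_neg, Finset.sum_neg_distrib] at h
    linarith

/-- Averaging over sign changes pinches a matrix to its diagonal when the diagonals of the
off-diagonal blocks vanish. -/
theorem diagSum_mem_convexHull_orbit (X : Mat n)
    (h12 : ∀ i, X (.inl i) (.inr i) = 0) (h21 : ∀ i, X (.inr i) (.inl i) = 0) :
    diagSum (Δ11 X) (Δ22 X) ∈ convexHull ℝ (orbit X) := by
  -- Being symplectic forces equal signs on both blocks, so averaging cannot kill the entries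
  -- pairing `inl i` with `inr i`; hence `h12` and `h21`.
  let D (s : Fin n → ℤˣ) : Mat n := diagSum (fun i => ((s i : ℤ) : ℝ)) (fun i => ((s i : ℤ) : ℝ))
  have hD (s : Fin n → ℤˣ) : D s * X * D s ∈ convexHull ℝ (orbit X) := by
    refine subset_convexHull ℝ _ ⟨D s, diagSum_mem_symplecticGroup fun i => ?_, ?_⟩
    · rcases Int.units_eq_one_or (s i) with h | h <;> simp [h]
    · rw [transpose_diagSum]
  have hsum : ∑ s, ((2 : ℝ) ^ n)⁻¹ • (D s * X * D s) = diagSum (Δ11 X) (Δ22 X) := by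
    have key (i j : Fin n) (x : ℝ) : ∑ s : Fin n → ℤˣ,
        ((2 : ℝ) ^ n)⁻¹ * (((s i : ℤ) : ℝ) * ((s j : ℤ) : ℝ) * x) = if i = j then x else 0 := by
      rw [← Finset.mul_sum, ← Finset.sum_mul, sum_sign_mul_sign]
      split_ifs <;> simp
    ext (i | i) (j | j) <;>
      simp only [Matrix.sum_apply, Matrix.smul_apply, smul_eq_mul, D, diagSum_conj_apply_inl_inl,
        diagSum_conj_apply_inl_inr, diagSum_conj_apply_inr_inl, diagSum_conj_apply_inr_inr, key]
    · by_cases h : i = j <;> simp [diagSum, Δ11, toBlocks₁₁, h]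
    · by_cases h : i = j <;> simp [diagSum, h, h12]
    · by_cases h : i = j <;> simp [diagSum, h, h21]
    · by_cases h : i = j <;> simp [diagSum, Δ22, toBlocks₂₂, h]
  rw [← hsum]
  refine (convex_convexHull ℝ _).sum_mem (fun _ _ => by positivity) ?_ fun s _ => hD s
  simp

/-- A symmetric matrix commuting with `J` has off-diagonal blocks with zero diagonal. -/
theorem apply_inl_inr_eq_zero_of_commute_J {X : Mat n} (hX : Xᵀ = X)
    (hJ : X * J (Fin n) ℝ = J (Fin n) ℝ * X) (i : Fin n) : X (.inl i) (.inr i) = 0 := by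
  -- This entry says that the two mirror entries sum to zero; by symmetry they are also equal.
  have h := congrFun (congrFun hJ (.inl i)) (.inl i)
  have hs : X (.inr i) (.inl i) = X (.inl i) (.inr i) := congrFun (congrFun hX (.inl i)) (.inr i)
  rw [← fromBlocks_toBlocks X] at h
  simp [J, fromBlocks_multiply, toBlocks₁₂, toBlocks₂₁] at h
  linarith

theorem rpow_quarter_mul_self_mul {a b : ℝ} (ha : 0 < a) (hb : 0 < b) :
    (a⁻¹ * b) ^ ((1 : ℝ) / 4) * (a⁻¹ * b) ^ ((1 : ℝ) / 4) * a = Real.sqrt (a * b) := by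
  rw [← Real.rpow_add (by positivity), show (1 : ℝ) / 4 + 1 / 4 = 1 / 2 by norm_num,
    ← Real.sqrt_eq_rpow]
  -- Writing the factor `a` as `√(a ^ 2)` puts everything under one root: `a⁻¹ * b * a ^ 2 = a * b`.
  nth_rewrite 2 [← Real.sqrt_sq ha.le]
  rw [← Real.sqrt_mul (by positivity)]
  congr 1
  field_simp

theorem rpow_quarter_mul_rpow_quarter {a b : ℝ} (ha : 0 < a) (hb : 0 < b) :
    (a⁻¹ * b) ^ ((1 : ℝ) / 4) * (b⁻¹ * a) ^ ((1 : ℝ) / 4) = 1 := by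
  rw [← Real.mul_rpow (by positivity) (by positivity),
    show a⁻¹ * b * (b⁻¹ * a) = 1 by field_simp, Real.one_rpow]

theorem Δ11_pos {A : Mat n} (hA : A.PosDef) (i : Fin n) : 0 < Δ11 A i := hA.diag_pos

theorem Δ22_pos {A : Mat n} (hA : A.PosDef) (i : Fin n) : 0 < Δ22 A i := hA.diag_pos

theorem Δs_pos {A : Mat n} (hA : A.PosDef) (i : Fin n) : 0 < Δs A i :=
  Real.sqrt_pos.2 (mul_pos (Δ11_pos hA i) (Δ22_pos hA i))

theorem scaling_mem_symplecticGroup {A : Mat n} (hA : A.PosDef) :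
    scaling A ∈ symplecticGroup (Fin n) ℝ :=
  diagSum_mem_symplecticGroup fun i =>
    rpow_quarter_mul_rpow_quarter (Δ11_pos hA i) (Δ22_pos hA i)

theorem Δ11_scaling_conj {A : Mat n} (hA : A.PosDef) :
    Δ11 (scaling A * A * scaling A) = Δs A := by
  ext i
  exact (diagSum_conj_apply_inl_inl _ _ A i i).trans
    (rpow_quarter_mul_self_mul (Δ11_pos hA i) (Δ22_pos hA i))

theorem Δ22_scaling_conj {A : Mat n} (hA : A.PosDef) :
    Δ22 (scaling A * A * scaling A) = Δs A := by
  ext i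
  refine (diagSum_conj_apply_inr_inr _ _ A i i).trans
    ((rpow_quarter_mul_self_mul (Δ22_pos hA i) (Δ11_pos hA i)).trans ?_)
  rw [mul_comm, Δs]

theorem scaling_conj_diagSum {A : Mat n} (hA : A.PosDef) :
    (scaling A)ᵀ * diagSum (Δ11 A) (Δ22 A) * scaling A = diagSum (Δs A) (Δs A) := by
  rw [scaling, transpose_diagSum, diagSum_mul_diagSum, diagSum_mul_diagSum]
  congr 1 <;> ext i
  · rw [Δs, ← rpow_quarter_mul_self_mul (Δ11_pos hA i) (Δ22_pos hA i)]
    ring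
  · rw [Δs, mul_comm (Δ11 A i), ← rpow_quarter_mul_self_mul (Δ22_pos hA i) (Δ11_pos hA i)]
    ring

theorem diagSum_Δs_mem_convexHull_orbit {A : Mat n} (hA : A.PosDef)
    (hJ : (scaling A * A * scaling A) * J (Fin n) ℝ = J (Fin n) ℝ * (scaling A * A * scaling A)) :
    diagSum (Δs A) (Δs A) ∈ convexHull ℝ (orbit A) := by
  set X := scaling A * A * scaling A with hXdef
  have hM : (scaling A)ᵀ = scaling A := transpose_diagSum _ _
  have hAt : Aᵀ = A := by simpa [conjTranspose_eq_transpose_of_trivial] using hA.isHermitian.eq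
  have hX : Xᵀ = X := by simp [hXdef, hM, hAt, Matrix.mul_assoc]
  have h12 := apply_inl_inr_eq_zero_of_commute_J hX hJ
  have h21 (i : Fin n) : X (.inr i) (.inl i) = 0 :=
    (congrFun (congrFun hX (.inl i)) (.inr i)).trans (h12 i)
  have h := diagSum_mem_convexHull_orbit X h12 h21
  rw [Δ11_scaling_conj hA, Δ22_scaling_conj hA] at h
  refine convexHull_mono ?_ h
  rintro _ ⟨S, hS, rfl⟩
  exact ⟨scaling A * S, mul_mem (scaling_mem_symplecticGroup hA) hS,
    by simp [hXdef, hM, Matrix.mul_assoc]⟩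

/-- Permuting the modes is a symplectic congruence. -/
theorem exists_symplectic_conj_diagSum_comp (v : Fin n → ℝ) (σ : Equiv.Perm (Fin n)) :
    ∃ S ∈ symplecticGroup (Fin n) ℝ, Sᵀ * diagSum v v * S = diagSum (v ∘ σ) (v ∘ σ) := by
  -- A permutation matrix is orthogonal, so `P ⊕ P` is symplectic.
  let P : Matrix (Fin n) (Fin n) ℝ := (1 : Matrix (Fin n) (Fin n) ℝ).submatrix id σ
  have hP : P * Pᵀ = 1 := by
    simp only [P, transpose_submatrix, transpose_one]
    rw [submatrix_mul_equiv, Matrix.mul_one, submatrix_id_id]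
  have hd : Pᵀ * diagonal v * P = diagonal (v ∘ σ) := by
    ext i j
    simp [P, Matrix.mul_apply, diagonal_apply, one_apply]
    aesop
  refine ⟨fromBlocks P 0 0 P, fromBlocks_diag_mem_symplecticGroup hP, ?_⟩
  simp only [diagSum, fromBlocks_transpose, fromBlocks_multiply, transpose_zero, Matrix.mul_zero,
    Matrix.zero_mul, add_zero, zero_add, hd]

/-- A positive value of `d` cannot be its default `0` unless `n = 0`, where all matrices agree. Thus
the existence half of Williamson's theorem is not needed. -/
theorem isSymplecticSpectrum_d {B : Mat n} {e : Fin n → ℝ} (h : d B = e) (he : ∀ i, 0 < e i) :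
    IsSymplecticSpectrum B e := by
  by_cases hB : ∃ e, IsSymplecticSpectrum B e
  · have := hB.choose_spec
    rwa [show hB.choose = e by rw [← h, d, dif_pos hB]] at this
  · rw [d, dif_neg hB] at h
    subst h
    have : IsEmpty (Fin n) := ⟨fun i => (he i).ne rfl⟩
    exact ⟨fun i => isEmptyElim i, isEmptyElim, 1, one_mem _, Subsingleton.elim _ _⟩

end Symp

theorem corollary3p5 (n : ℕ) (A : Symp.Mat n) (hA : A.PosDef)
    (hJ : (Symp.scaling A * A * Symp.scaling A) * Matrix.J (Fin n) ℝ =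
      Matrix.J (Fin n) ℝ * (Symp.scaling A * A * Symp.scaling A)) :
    (∀ B : Symp.Mat n, B.PosDef → Symp.d B = Symp.sortUp (Symp.Δs A) →
      B ∈ convexHull ℝ (Symp.orbit A)) ∧
    Symp.diagSum (Symp.Δ11 A) (Symp.Δ22 A) ∈ convexHull ℝ (Symp.orbit A) := by
  have h := Symp.diagSum_Δs_mem_convexHull_orbit hA hJ
  refine ⟨fun B _ hB => ?_, Symp.mem_convexHull_orbit_of_conj_eq
    (Symp.scaling_mem_symplecticGroup hA) h (Symp.scaling_conj_diagSum hA)⟩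
  obtain ⟨-, -, S, hS, hSB⟩ := Symp.isSymplecticSpectrum_d hB fun i => Symp.Δs_pos hA _
  obtain ⟨T, hT, hTd⟩ := Symp.exists_symplectic_conj_diagSum_comp (Symp.Δs A)
    (Tuple.sort (Symp.Δs A))
  refine Symp.mem_convexHull_orbit_of_conj_eq hS ?_ hSB
  exact hTd ▸ Symp.conj_mem_convexHull_orbit hT h
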